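/- Let $K$ be a field. For a finite simple graph $G$ with vertex set $V(G)$ let $S = K[x_v : v \in V(G)]$ with the standard grading, let $I(G) = (x_v x_w : vw \text{ is an edge of } G) \subseteq S$ be its edge ideal, and let $$\operatorname{reg}(I(G)) = \max\{\, j - m : \operatorname{Tor}^S_m(I(G),K)_j \neq 0 \,\}$$ be its Castelnuovo–Mumford regularity (with $\operatorname{reg}(0) = \max \emptyset = -\infty$). The star of a vertex $x$ consists of $x$ and its neighbours. A graph property $P$ is called stable if for every finite simple graph $G$ satisfying $P$ and every vertex $x$ of $G$ of maximal degree, both $G - \operatorname{st} x$ and $G - x$ satisfy $P$. Let $P$ be a stable graph property, and let $g, f : \mathbb{R}_{\ge 0} \to \mathbb{R}_{\ge 0}$ be non-decreasing functions such that: 1. if $G$ is a finite simple graph satisfying $P$ with no vertex of degree greater than $d$ (where $d \in \mathbb{Z}_{\ge 0}$), then $\operatorname{reg}(I(G)) \le g(d)$; 2. $f$ is concave and differentiable on $\mathbb{R}_{\ge 0}$ (one-sidedly at $0$), and $f(1) \ge 2$; 3. $f'(x) > 0$ for all $x \ge 0$, and $g\left(\frac{1}{f'(x)} - 1\right) \le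 f(x)$ for all $x \ge 0$ for which $\frac{1}{f'(x)} - 1 \ge 0$ (that is, for which the argument lies in the domain of $g$). Then every finite simple graph $G$ on $n$ vertices satisfying $P$ has $\operatorname{reg}(I(G)) \le f(n)$. -/

import Mathlib

open Set MvPolynomial

universe u v w

noncomputable section

section Koszul

variable (V : Type u) [Fintype V] (K : Type v) [Field K]
  (M : Type w) [AddCommGroup M] [Module K M] [Module (MvPolynomial V K) M]
  [IsScalarTower K (MvPolynomial V K) M]

/-- The term of homological degree `m` of the Koszul complex of the variables with coefficients
in `M`, that is `M ⊗ₖ ⋀ᵐ Kⱽ`. An element `∑ c_{v₁ … vₘ} ⊗ e_{v₁} ∧ ⋯ ∧ e_{vₘ}` is recorded by its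
alternating family of coefficients `c (e_{v₁}, …, e_{vₘ}) = c_{v₁ … vₘ}` in `M`. -/
abbrev KoszulChain (V : Type u) (K : Type v) [Field K] (M : Type w) [AddCommGroup M]
    [Module K M] (m : ℕ) :=
  (V → K) [⋀^Fin m]→ₗ[K] M

open Classical in
/-- The Koszul differential `M ⊗ₖ ⋀ᵐ⁺¹ Kⱽ → M ⊗ₖ ⋀ᵐ Kⱽ`, which sends `e_{v₁} ∧ ⋯ ∧ e_{vₘ₊₁}` to
`∑ᵢ (-1)ⁱ⁻¹ x_{vᵢ} e_{v₁} ∧ ⋯ ∧ ê_{vᵢ} ∧ ⋯ ∧ e_{vₘ₊₁}`. On coefficient families it is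
`(∂ c)(v₁, …, vₘ) = ∑ᵥ xᵥ • c(v, v₁, …, vₘ)`. -/
def koszulD (m : ℕ) : KoszulChain V K M (m + 1) →ₗ[K] KoszulChain V K M m where
  toFun c := ∑ v : V,
    (Module.toModuleEnd K (S := MvPolynomial V K) M (X v)).compAlternatingMap
      (c.curryLeft (Pi.single v (1 : K)))
  map_add' c c' := by
    ext t
    simp [Finset.sum_add_distrib]
  map_smul' r c := by
    ext t
    simp [Finset.smul_sum]

open Classical in
theorem koszulD_apply (m : ℕ) (c : KoszulChain V K M (m + 1)) (t : Fin m → V → K) :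
    koszulD V K M m c t =
      ∑ v : V, (X v : MvPolynomial V K) • c (Matrix.vecCons (Pi.single v (1 : K)) t) := by
  have h : ∀ (s : Finset V) (F : V → KoszulChain V K M m), (∑ v ∈ s, F v) t = ∑ v ∈ s, F v t := by
    intro s F
    induction s using Finset.induction_on with
    | empty => simp
    | insert a s ha ih => simp [Finset.sum_insert ha, ih]
  exact h Finset.univ _

/-- The Koszul differential squares to zero. -/
theorem koszulD_koszulD (m : ℕ) (c : KoszulChain V K M (m + 1 + 1)) :
    koszulD V K M m (koszulD V K M (m + 1) c) = 0 := by
  classical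
  ext t
  simp only [koszulD_apply, Finset.smul_sum, AlternatingMap.zero_apply]
  rw [← Finset.sum_product']
  refine Finset.sum_involution (fun p _ => (p.2, p.1)) ?_ ?_ (by simp) (by simp)
  · rintro ⟨a, b⟩ -
    have hs : ∀ x y : V → K,
        c (Matrix.vecCons x (Matrix.vecCons y t)) = -c (Matrix.vecCons y (Matrix.vecCons x t)) := by
      intro x y
      rw [← c.map_swap _ (Fin.zero_ne_one (n := m))]
      congr 1
      funext i
      refine Fin.cases ?_ (fun i => ?_) i
      · simp
      · refine Fin.cases ?_ (fun i => ?_) i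
        · simp
        · have h0 : i.succ.succ ≠ 0 := Fin.succ_ne_zero _
          have h1 : i.succ.succ ≠ 1 := by simp [Fin.ext_iff]
          simp [Equiv.swap_apply_of_ne_of_ne h0 h1]
    dsimp only
    rw [hs (Pi.single b 1), smul_neg, smul_neg, smul_smul, smul_smul, mul_comm, neg_add_cancel]
  · rintro ⟨a, b⟩ - h heq
    simp only [Prod.mk.injEq] at heq
    apply h
    have : c (Matrix.vecCons (Pi.single b (1 : K)) (Matrix.vecCons (Pi.single a 1) t)) = 0 :=
      c.map_eq_zero_of_eq _ (i := 0) (j := 1) (by simp [heq.1]) (by simp)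
    simp only [this, smul_zero]

/-- Cycles of the Koszul complex with coefficients in `M`, in homological degree `m`. -/
def koszulCycles : (m : ℕ) → Submodule K (KoszulChain V K M m)
  | 0 => ⊤
  | m + 1 => LinearMap.ker (koszulD V K M m)

/-- The part of internal degree `j` of `M ⊗ₖ ⋀ᵐ Kⱽ`, where `M` is graded by `ℳ` and the basis
elements of `Kⱽ` have degree `1`: the coefficients lie in `ℳ (j - m)`. -/
def koszulDegree {K : Type v} [Field K] {M : Type w} [AddCommGroup M] [Module K M]
    (ℳ : ℤ → Submodule K M) (m : ℕ) (j : ℤ) :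
    Submodule K (KoszulChain V K M m) where
  carrier := {c | ∀ t, c t ∈ ℳ (j - m)}
  zero_mem' t := by simp
  add_mem' h h' t := by simpa using add_mem (h t) (h' t)
  smul_mem' r c h t := by simpa using (ℳ (j - m)).smul_mem r (h t)

/-- `Tor_m^S(M, K)_j` for `S = K[x_v : v ∈ V]` and a graded `S`-module `M = ⨁ⱼ ℳ j`: the homology
in homological degree `m` and internal degree `j` of `M ⊗ F`, where `F` is the Koszul complex on
the variables, which is the graded free resolution of `K = S / (x_v : v ∈ V)`. -/
abbrev GradedTor (V : Type u) [Fintype V] {K : Type v} [Field K]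
    {M : Type w} [AddCommGroup M] [Module K M] [Module (MvPolynomial V K) M]
    [IsScalarTower K (MvPolynomial V K) M] (ℳ : ℤ → Submodule K M) (m : ℕ) (j : ℤ) :=
  ↥(koszulCycles V K M m ⊓ koszulDegree V ℳ m j) ⧸
    ((koszulDegree V ℳ (m + 1) j).map (koszulD V K M m)).comap
      (koszulCycles V K M m ⊓ koszulDegree V ℳ m j).subtype

theorem nontrivial_gradedTor_iff (V : Type u) [Fintype V] {K : Type v} [Field K]
    {M : Type w} [AddCommGroup M] [Module K M] [Module (MvPolynomial V K) M]
    [IsScalarTower K (MvPolynomial V K) M] (ℳ : ℤ → Submodule K M) (m : ℕ) (j : ℤ) :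
    Nontrivial (GradedTor V ℳ m j) ↔
      ∃ c : KoszulChain V K M m, c ∈ koszulCycles V K M m ∧ (∀ t, c t ∈ ℳ (j - m)) ∧
        ∀ b : KoszulChain V K M (m + 1), (∀ t, b t ∈ ℳ (j - (m + 1 : ℕ))) →
          koszulD V K M m b ≠ c := by
  rw [Submodule.Quotient.nontrivial_iff, Ne, Submodule.eq_top_iff']
  push Not
  constructor
  · rintro ⟨⟨c, hc, hd⟩, h⟩
    exact ⟨c, hc, hd, fun b hb hbc => h ⟨b, hb, hbc⟩⟩
  · rintro ⟨c, hc, hd, h⟩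
    refine ⟨⟨c, hc, hd⟩, ?_⟩
    rintro ⟨b, hb, hbc⟩
    exact h b hb hbc

/-- The Castelnuovo–Mumford regularity `reg M = max {j - m : Tor_m^S(M, K)_j ≠ 0}` of a graded
module over `K[x_v : v ∈ V]`. For `M = 0` the maximum is over the empty set and equals `⊥ = -∞`. -/
def regularity (V : Type u) [Fintype V] {K : Type v} [Field K]
    {M : Type w} [AddCommGroup M] [Module K M] [Module (MvPolynomial V K) M]
    [IsScalarTower K (MvPolynomial V K) M] (ℳ : ℤ → Submodule K M) : EReal :=
  sSup {r : EReal | ∃ (m : ℕ) (j : ℤ), Nontrivial (GradedTor V ℳ m j) ∧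
    r = (((j : ℝ) - (m : ℝ) : ℝ) : EReal)}

end Koszul

section EdgeIdeal

variable {V : Type u}

/-- The grading of an ideal of a polynomial ring by degree: the elements of `I` that are
homogeneous of degree `j` (only `0` if `j < 0`). -/
def idealPiece {K : Type v} [Field K] (I : Ideal (MvPolynomial V K)) (j : ℤ) : Submodule K I where
  carrier := {p | ∀ a, coeff a (p : MvPolynomial V K) ≠ 0 → (a.degree : ℤ) = j}
  zero_mem' a h := by simp at h
  add_mem' {p q} hp hq a h := by
    by_cases h0 : coeff a (p : MvPolynomial V K) = 0
    · refine hq a fun h1 => h ?_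
      simp [h0, h1]
    · exact hp a h0
  smul_mem' r p hp a h := by
    refine hp a fun h0 => h ?_
    simp [h0]

/-- The edge ideal `I(G) = (x_v x_w : vw is an edge of G)` over the field `K`. -/
def edgeIdeal (K : Type v) [Field K] (G : SimpleGraph V) : Ideal (MvPolynomial V K) :=
  Ideal.span {p | ∃ x y, G.Adj x y ∧ p = X x * X y}

/-- `reg(G) = reg(I(G))`, computed over the field `K`. -/
def graphReg (K : Type v) [Field K] [Fintype V] (G : SimpleGraph V) : EReal :=
  regularity V (idealPiece (edgeIdeal K G))

/-- The star of `x`: the vertex `x` together with its neighbours. -/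
def graphStar (G : SimpleGraph V) (x : V) : Set V := {y | G.Adj x y} ∪ {x}

end EdgeIdeal

/-- A graph property `P` is stable if deleting a vertex of maximal degree, or its star, from a
finite graph with `P` leaves a graph with `P`. -/
def StableProperty (P : ∀ V : Type u, SimpleGraph V → Prop) : Prop :=
  ∀ (V : Type u) [Fintype V] (G : SimpleGraph V) [DecidableRel G.Adj], P V G →
    ∀ x : V, (∀ y, G.degree y ≤ G.degree x) →
      P ↥(graphStar G x)ᶜ (G.induce (graphStar G x)ᶜ) ∧
        P ↥({x} : Set V)ᶜ (G.induce ({x} : Set V)ᶜ)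

end

/-! Let `d` be the maximal degree of `G`, attained at `x`. If `g(d) ≤ f(n)`, the bound for graphs of
maximal degree `d` suffices. Otherwise condition 3 and monotonicity of `g` force `f'(n)(d + 1) ≥ 1`.
A concave function lies below its tangents, so `f(n - d - 1) ≤ f(n) - f'(n)(d + 1) ≤ f(n) - 1`.
Induction on `n` bounds the regularity of `G - st x` by `f(n) - 1` and that of `G - x` by `f(n)`.
What remains is `reg I(G) ≤ max {2, reg I(G - st x) + 1, reg I(G - x)}`
(`graphReg_le_of_star_of_vertex`), where `2 ≤ f(1) ≤ f(n)` absorbs the 2.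

For this inequality, filter `I = I(G)` by `I ∩ (x)`. The quotient `I / (I ∩ (x))` is `I(G - x)` with
`x` acting as zero. The ideal `I ∩ (x)` is `x (I : x)` with `I : x = I + (N(x))`. Here `(N(x))` has
regularity at most 1, and `x` is regular on `(I + (N(x))) / (N(x))`, which modulo `x` becomes `I(G -
st x)`.

By `graphReg_le_iff`, `reg ≤ r` means that the Koszul complex is exact in every coefficient degree
`k = j - m > r`. Subquotients are recorded by pairs of exponent sets, and each step above is a
closure property of exactness: `KoszulExact.trans`, `KoszulExact.congr`, `KoszulExact.shift`,
`KoszulExact.of_regular`, `KoszulExact.of_subtype`. The last two rest on the homotopy `∂(e_y ∧ c) +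
e_y ∧ ∂c = x_y c` of `koszulD_wedge`. -/

noncomputable section

/-! ### Exterior multiplication and contraction on the Koszul complex -/

section KoszulOperators

variable {V : Type u} {K : Type v} [Field K]

/-- The chains of the Koszul complex all of whose coefficients lie in `Q`. -/
def chainsIn {M : Type w} [AddCommGroup M] [Module K M] (Q : Submodule K M) (m : ℕ) :
    Submodule K (KoszulChain V K M m) where
  carrier := {c | ∀ t, c t ∈ Q}
  zero_mem' t := by simp
  add_mem' h h' t := by simpa using add_mem (h t) (h' t)
  smul_mem' r c h t := by simpa using Q.smul_mem r (h t)

theorem chainsIn_mono {M : Type w} [AddCommGroup M] [Module K M] {Q Q' : Submodule K M}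
    (h : Q ≤ Q') (m : ℕ) : chainsIn (V := V) Q m ≤ chainsIn Q' m := fun _ hc t => h (hc t)

theorem koszulChain_sum_apply {ι : Type*} {M : Type w} [AddCommGroup M] [Module K M] {m : ℕ}
    (s : Finset ι) (F : ι → KoszulChain V K M m) (t : Fin m → V → K) :
    (∑ i ∈ s, F i) t = ∑ i ∈ s, F i t := by
  classical
  induction s using Finset.induction_on with
  | empty => simp
  | insert a s ha ih => simp [Finset.sum_insert ha, ih]

/-- Left exterior multiplication by the basis element `e_y`. -/
def wedge (y : V) {M : Type w} [AddCommGroup M] [Module K M] {m : ℕ} (c : KoszulChain V K M m) :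
    KoszulChain V K M (m + 1) :=
  AlternatingMap.alternatizeUncurryFin
    (LinearMap.smulRight (LinearMap.proj y : (V → K) →ₗ[K] K) c)

theorem wedge_apply (y : V) {M : Type w} [AddCommGroup M] [Module K M] {m : ℕ}
    (c : KoszulChain V K M m) (t : Fin (m + 1) → V → K) :
    wedge y c t = ∑ i : Fin (m + 1), (-1) ^ (i : ℕ) • t i y • c (i.removeNth t) := by
  simp [wedge, AlternatingMap.alternatizeUncurryFin_apply]

theorem wedge_mem_chainsIn (y : V) {M : Type w} [AddCommGroup M] [Module K M] {m : ℕ}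
    {Q : Submodule K M} {c : KoszulChain V K M m} (hc : c ∈ chainsIn Q m) :
    wedge y c ∈ chainsIn Q (m + 1) := by
  intro t
  rw [wedge_apply]
  exact Submodule.sum_mem _ fun i _ => Submodule.smul_of_tower_mem _ _ (Q.smul_mem _ (hc _))

open Classical in
/-- Contraction with the coordinate `y`. -/
def contract (y : V) {M : Type w} [AddCommGroup M] [Module K M] {m : ℕ}
    (c : KoszulChain V K M (m + 1)) : KoszulChain V K M m :=
  c.curryLeft (Pi.single y (1 : K))

open Classical in
theorem contract_apply (y : V) {M : Type w} [AddCommGroup M] [Module K M] {m : ℕ}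
    (c : KoszulChain V K M (m + 1)) (t : Fin m → V → K) :
    contract y c t = c (Matrix.vecCons (Pi.single y (1 : K)) t) := rfl

theorem contract_mem_chainsIn (y : V) {M : Type w} [AddCommGroup M] [Module K M] {m : ℕ}
    {Q : Submodule K M} {c : KoszulChain V K M (m + 1)} (hc : c ∈ chainsIn Q (m + 1)) :
    contract y c ∈ chainsIn Q m := fun _ => hc _

theorem map_vecCons_swap {M : Type w} [AddCommGroup M] [Module K M] {m : ℕ}
    (c : KoszulChain V K M (m + 1 + 1)) (x y : V → K) (t : Fin m → V → K) :
    c (Matrix.vecCons x (Matrix.vecCons y t)) = -c (Matrix.vecCons y (Matrix.vecCons x t)) := by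
  rw [← c.map_swap _ (Fin.zero_ne_one (n := m))]
  congr 1
  funext i
  refine Fin.cases ?_ (fun i => ?_) i
  · simp
  · refine Fin.cases ?_ (fun i => ?_) i
    · simp
    · have h0 : i.succ.succ ≠ 0 := Fin.succ_ne_zero _
      have h1 : i.succ.succ ≠ 1 := by simp [Fin.ext_iff]
      simp [Equiv.swap_apply_of_ne_of_ne h0 h1]

open Classical in
-- The anticommutation relation of the exterior algebra: the term `i = 0` of the alternating sum
-- gives the Kronecker delta, the other terms give the wedge of the contraction.
theorem contract_wedge (u y : V) {M : Type w} [AddCommGroup M] [Module K M] {m : ℕ}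
    (c : KoszulChain V K M (m + 1)) :
    contract u (wedge y c) = (if u = y then (1 : K) else 0) • c - wedge y (contract u c) := by
  ext t
  rw [contract_apply, wedge_apply, Fin.sum_univ_succ, AlternatingMap.sub_apply, wedge_apply,
    sub_eq_add_neg, ← Finset.sum_neg_distrib]
  congr 1
  · by_cases h : u = y
    · simp [h, Fin.removeNth_zero]
    · simp [h, Ne.symm h]
  · refine Finset.sum_congr rfl fun i _ => ?_
    rw [contract_apply]
    have : (i.succ.removeNth (Matrix.vecCons (Pi.single u (1 : K)) t) : Fin (m + 1) → V → K) =
        Matrix.vecCons (Pi.single u (1 : K)) (i.removeNth t) := by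
      funext j
      refine Fin.cases ?_ (fun j => ?_) j
      · simp [Fin.removeNth]
      · simp [Fin.removeNth]
    rw [this]
    simp [pow_succ]

open Classical in
theorem contract_wedge_zero (u y : V) {M : Type w} [AddCommGroup M] [Module K M]
    (c : KoszulChain V K M 0) :
    contract u (wedge y c) = (if u = y then (1 : K) else 0) • c := by
  ext t
  rw [contract_apply, wedge_apply]
  by_cases h : u = y
  · simp [h, Fin.removeNth_zero]
  · simp [h, Ne.symm h]

variable [Fintype V]

theorem koszulD_eq_sum_contract {m : ℕ} (c : KoszulChain V K (MvPolynomial V K) (m + 1)) :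
    koszulD V K _ m c = ∑ v : V, (X v : MvPolynomial V K) • contract v c := by
  ext1 t
  rw [koszulD_apply]
  simp [koszulChain_sum_apply, contract_apply]

theorem koszulD_smul {m : ℕ} (p : MvPolynomial V K)
    (c : KoszulChain V K (MvPolynomial V K) (m + 1)) :
    koszulD V K _ m (p • c) = p • koszulD V K _ m c := by
  ext1 t
  simp only [koszulD_apply, AlternatingMap.smul_apply, Finset.smul_sum]
  exact Finset.sum_congr rfl fun v _ => smul_comm _ _ _

theorem wedge_sum_smul (y : V) {m : ℕ} (p : V → MvPolynomial V K)
    (c : V → KoszulChain V K (MvPolynomial V K) m) :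
    wedge y (∑ v, p v • c v) = ∑ v, p v • wedge y (c v) := by
  ext1 t
  simp only [wedge_apply, koszulChain_sum_apply, AlternatingMap.smul_apply, Finset.smul_sum]
  rw [Finset.sum_comm]
  refine Finset.sum_congr rfl fun i _ => Finset.sum_congr rfl fun v _ => ?_
  rw [smul_comm (t v y), smul_comm ((-1 : ℤ) ^ (v : ℕ))]

/-- Follows from `∂ = ∑ x_v ι_v` and the anticommutation relation. Thus `e_y ∧ ·` is a homotopy
showing that `x_y` acts as zero on Koszul homology. -/
theorem koszulD_wedge (y : V) {m : ℕ} (c : KoszulChain V K (MvPolynomial V K) (m + 1)) :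
    koszulD V K _ (m + 1) (wedge y c) =
      (X y : MvPolynomial V K) • c - wedge y (koszulD V K _ m c) := by
  classical
  rw [koszulD_eq_sum_contract, koszulD_eq_sum_contract, wedge_sum_smul]
  simp only [contract_wedge, smul_sub, Finset.sum_sub_distrib, ite_smul, one_smul, zero_smul,
    smul_ite, smul_zero]
  simp

theorem koszulD_wedge_zero (y : V) (c : KoszulChain V K (MvPolynomial V K) 0) :
    koszulD V K _ 0 (wedge y c) = (X y : MvPolynomial V K) • c := by
  classical
  rw [koszulD_eq_sum_contract]
  simp only [contract_wedge_zero, ite_smul, one_smul, zero_smul, smul_ite, smul_zero]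
  simp

theorem contract_koszulD (y : V) {m : ℕ}
    (c : KoszulChain V K (MvPolynomial V K) (m + 1 + 1)) :
    contract y (koszulD V K _ (m + 1) c) = - koszulD V K _ m (contract y c) := by
  ext1 t
  rw [AlternatingMap.neg_apply, contract_apply, koszulD_apply, koszulD_apply,
    ← Finset.sum_neg_distrib]
  refine Finset.sum_congr rfl fun v _ => ?_
  rw [contract_apply, map_vecCons_swap, smul_neg]

end KoszulOperators

/-! ### Koszul exactness for subquotients of monomial ideals -/

section MonomialModules

variable {V : Type u} {K : Type v} [Field K]

theorem mem_restrictSupport_iff_coeff {A : Set (V →₀ ℕ)} {p : MvPolynomial V K} :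
    p ∈ restrictSupport K A ↔ ∀ a, coeff a p ≠ 0 → a ∈ A := by
  rw [mem_restrictSupport_iff]
  exact ⟨fun h a ha => h (by simpa using ha), fun h a ha => h a (by simpa using ha)⟩

theorem X_mul_mem_restrictSupport {A A' : Set (V →₀ ℕ)} {v : V}
    (h : ∀ a ∈ A, a + Finsupp.single v 1 ∈ A') {p : MvPolynomial V K}
    (hp : p ∈ restrictSupport K A) : X v * p ∈ restrictSupport K A' := by
  classical
  rw [mem_restrictSupport_iff_coeff] at hp ⊢
  intro a ha
  rw [coeff_X_mul'] at ha
  split_ifs at ha with hv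
  · have := h _ (hp _ ha)
    rwa [tsub_add_cancel_of_le] at this
    rw [Finsupp.single_le_iff]
    exact Nat.one_le_iff_ne_zero.2 (by simpa using hv)
  · exact absurd rfl ha

theorem mem_restrictSupport_of_X_mul {A A' : Set (V →₀ ℕ)} {v : V}
    (h : ∀ a, a + Finsupp.single v 1 ∈ A' → a ∈ A) {p : MvPolynomial V K}
    (hp : X v * p ∈ restrictSupport K A') : p ∈ restrictSupport K A := by
  rw [mem_restrictSupport_iff_coeff] at hp ⊢
  intro a ha
  refine h a (hp _ ?_)
  rwa [add_comm, coeff_X_mul]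

open Classical in
/-- The `K`-linear projection of the polynomial ring onto the span of the monomials with exponent
in `A`. -/
def supportProj (K : Type v) [Field K] (A : Set (V →₀ ℕ)) :
    MvPolynomial V K →ₗ[K] MvPolynomial V K :=
  (basisMonomials V K).constr K fun a => if a ∈ A then monomial a 1 else 0

open Classical in
theorem coeff_supportProj (A : Set (V →₀ ℕ)) (p : MvPolynomial V K) (a : V →₀ ℕ) :
    coeff a (supportProj K A p) = if a ∈ A then coeff a p else 0 := by
  induction p using MvPolynomial.induction_on' with
  | monomial b r =>
    have hb : monomial b r = r • basisMonomials V K b := by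
      simp [smul_monomial]
    rw [hb, map_smul, supportProj, Module.Basis.constr_basis]
    by_cases hab : b = a
    · subst hab
      by_cases h : b ∈ A <;> simp [h]
    · by_cases h : b ∈ A <;> simp [h, hab]
  | add p q hp hq =>
    rw [map_add, coeff_add, hp, hq, coeff_add]
    split_ifs <;> simp

/-- Projecting onto a set of monomials is `K`-linear, though not linear over the polynomial ring, so
applying it to the coefficients preserves alternation. -/
theorem exists_chain_split (A C : Set (V →₀ ℕ)) {m : ℕ}
    {c : KoszulChain V K (MvPolynomial V K) m} (hc : c ∈ chainsIn (restrictSupport K C) m) :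
    ∃ c₁ ∈ chainsIn (restrictSupport K (C ∩ A)) m,
      ∃ c₂ ∈ chainsIn (restrictSupport K (C \ A)) m, c = c₁ + c₂ := by
  classical
  refine ⟨(supportProj K A).compAlternatingMap c, fun t => ?_,
    c - (supportProj K A).compAlternatingMap c, fun t => ?_, by simp⟩
  · rw [mem_restrictSupport_iff_coeff]
    intro a ha
    have h := mem_restrictSupport_iff_coeff.1 (hc t) a
    rw [LinearMap.compAlternatingMap_apply, coeff_supportProj] at ha
    split_ifs at ha with h'
    · exact ⟨h ha, h'⟩
    · exact absurd rfl ha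
  · rw [mem_restrictSupport_iff_coeff]
    intro a ha
    have h := mem_restrictSupport_iff_coeff.1 (hc t) a
    rw [AlternatingMap.sub_apply, LinearMap.compAlternatingMap_apply, coeff_sub,
      coeff_supportProj] at ha
    split_ifs at ha with h'
    · exact absurd (sub_self _) ha
    · exact ⟨h (by simpa using ha), h'⟩

theorem exists_chain_eq_X_smul {y : V} {C : Set (V →₀ ℕ)} (hC : ∀ a ∈ C, a y ≠ 0) {m : ℕ}
    {c : KoszulChain V K (MvPolynomial V K) m} (hc : c ∈ chainsIn (restrictSupport K C) m) :
    ∃ c' ∈ chainsIn (restrictSupport K {a | a + Finsupp.single y 1 ∈ C}) m,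
      c = (X y : MvPolynomial V K) • c' := by
  classical
  let div : MvPolynomial V K →ₗ[K] MvPolynomial V K :=
    { toFun := fun p => p.divMonomial (Finsupp.single y 1)
      map_add' := fun p q => add_divMonomial p q _
      map_smul' := fun r p => by
        ext a
        simp [coeff_divMonomial] }
  have key : c = (X y : MvPolynomial V K) • div.compAlternatingMap c := by
    ext t a
    change _ = coeff a (X y * (c t).divMonomial (Finsupp.single y 1))
    rw [coeff_X_mul']
    have h := mem_restrictSupport_iff_coeff.1 (hc t) a
    split_ifs with hy
    · rw [coeff_divMonomial, add_tsub_cancel_of_le]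
      rw [Finsupp.single_le_iff]
      exact Nat.one_le_iff_ne_zero.2 (by simpa using hy)
    · by_contra h0
      exact hC a (h h0) (by simpa using hy)
  refine ⟨div.compAlternatingMap c, fun t => ?_, key⟩
  refine mem_restrictSupport_of_X_mul (v := y) (A' := C) (fun a ha => ha) ?_
  have := hc t
  rw [key] at this
  exact this

theorem X_smul_mem_chainsIn {A A' : Set (V →₀ ℕ)} {v : V}
    (h : ∀ a ∈ A, a + Finsupp.single v 1 ∈ A') {m : ℕ}
    {c : KoszulChain V K (MvPolynomial V K) m} (hc : c ∈ chainsIn (restrictSupport K A) m) :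
    (X v : MvPolynomial V K) • c ∈ chainsIn (restrictSupport K A') m :=
  fun t => X_mul_mem_restrictSupport h (hc t)

/-- The exponents of total degree `k`. -/
def degreeSet (V : Type u) (k : ℤ) : Set (V →₀ ℕ) := {a | (a.degree : ℤ) = k}

theorem add_single_mem_degreeSet {k : ℤ} {a : V →₀ ℕ} {v : V} :
    a + Finsupp.single v 1 ∈ degreeSet V k ↔ a ∈ degreeSet V (k - 1) := by
  simp only [degreeSet, Set.mem_ofPred_eq, map_add, Finsupp.degree_single]
  push_cast
  omega

theorem IsUpperSet.add_single_mem {A : Set (V →₀ ℕ)} (hA : IsUpperSet A) {a : V →₀ ℕ}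
    (ha : a ∈ A) (v : V) : a + Finsupp.single v 1 ∈ A :=
  hA le_self_add ha

variable [Fintype V]

theorem koszulD_mem_chainsIn {A A' : Set (V →₀ ℕ)}
    (h : ∀ v, ∀ a ∈ A, a + Finsupp.single v 1 ∈ A') {m : ℕ}
    {c : KoszulChain V K (MvPolynomial V K) (m + 1)}
    (hc : c ∈ chainsIn (restrictSupport K A) (m + 1)) :
    koszulD V K _ m c ∈ chainsIn (restrictSupport K A') m := by
  intro t
  rw [koszulD_apply]
  exact Submodule.sum_mem _ fun v _ => X_mul_mem_restrictSupport (h v) (hc _)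

/-- The chains whose Koszul boundary has coefficients in `Q`. -/
def cyclesMod {M : Type w} [AddCommGroup M] [Module K M] [Module (MvPolynomial V K) M]
    [IsScalarTower K (MvPolynomial V K) M] (Q : Submodule K M) :
    (m : ℕ) → Submodule K (KoszulChain V K M m)
  | 0 => ⊤
  | m + 1 => (chainsIn Q m).comap (koszulD V K M m)

theorem mem_cyclesMod_succ {M : Type w} [AddCommGroup M] [Module K M]
    [Module (MvPolynomial V K) M] [IsScalarTower K (MvPolynomial V K) M] {Q : Submodule K M}
    {m : ℕ} {c : KoszulChain V K M (m + 1)} :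
    c ∈ cyclesMod Q (m + 1) ↔ koszulD V K M m c ∈ chainsIn Q m := Iff.rfl

theorem cyclesMod_mono {M : Type w} [AddCommGroup M] [Module K M] [Module (MvPolynomial V K) M]
    [IsScalarTower K (MvPolynomial V K) M] {Q Q' : Submodule K M} (h : Q ≤ Q') (m : ℕ) :
    cyclesMod (V := V) Q m ≤ cyclesMod Q' m := by
  cases m with
  | zero => exact le_rfl
  | succ m => exact fun (c : KoszulChain V K M (m + 1)) hc => chainsIn_mono h m hc

theorem koszulD_mem_cyclesMod {M : Type w} [AddCommGroup M] [Module K M]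
    [Module (MvPolynomial V K) M] [IsScalarTower K (MvPolynomial V K) M] (Q : Submodule K M)
    {m : ℕ} (b : KoszulChain V K M (m + 1)) : koszulD V K M m b ∈ cyclesMod Q m := by
  cases m with
  | zero => trivial
  | succ m =>
    change koszulD V K M m (koszulD V K M (m + 1) b) ∈ chainsIn Q m
    rw [koszulD_koszulD]
    exact zero_mem _

theorem chainsIn_le_cyclesMod {B : Set (V →₀ ℕ)} (hB : IsUpperSet B) (m : ℕ) :
    chainsIn (V := V) (restrictSupport K B) m ≤ cyclesMod (restrictSupport K B) m := by
  cases m with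
  | zero => exact le_top
  | succ m => exact fun c hc => koszulD_mem_chainsIn (fun v a ha => hB.add_single_mem ha v) hc

theorem mem_cyclesMod_inter {A B : Set (V →₀ ℕ)} {m : ℕ}
    {c : KoszulChain V K (MvPolynomial V K) m} (hA : c ∈ cyclesMod (restrictSupport K A) m)
    (hB : c ∈ cyclesMod (restrictSupport K B) m) :
    c ∈ cyclesMod (restrictSupport K (A ∩ B)) m := by
  cases m with
  | zero => trivial
  | succ m =>
    intro t
    rw [mem_restrictSupport_iff_coeff]
    exact fun a ha => ⟨mem_restrictSupport_iff_coeff.1 (hA t) a ha,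
      mem_restrictSupport_iff_coeff.1 (hB t) a ha⟩

theorem mem_cyclesMod_of_X_smul {A A' : Set (V →₀ ℕ)} {v : V}
    (h : ∀ a, a + Finsupp.single v 1 ∈ A' → a ∈ A) {m : ℕ}
    {c : KoszulChain V K (MvPolynomial V K) m}
    (hc : (X v : MvPolynomial V K) • c ∈ cyclesMod (restrictSupport K A') m) :
    c ∈ cyclesMod (restrictSupport K A) m := by
  cases m with
  | zero => trivial
  | succ m =>
    intro t
    refine mem_restrictSupport_of_X_mul h ?_
    have := hc t
    rw [koszulD_smul] at this
    exact this

/-- The homotopy formula modulo `Q`: the error `e` is `e_y ∧ ∂c`, and it vanishes in homological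
degree 0. -/
theorem exists_X_smul_eq_koszulD_wedge_add (y : V) {Q : Submodule K (MvPolynomial V K)} {m : ℕ}
    {c : KoszulChain V K (MvPolynomial V K) m} (hc : c ∈ cyclesMod Q m) :
    ∃ e ∈ chainsIn Q m, (X y : MvPolynomial V K) • c = koszulD V K _ m (wedge y c) + e := by
  cases m with
  | zero => exact ⟨0, zero_mem _, by rw [koszulD_wedge_zero, add_zero]⟩
  | succ m =>
    exact ⟨wedge y (koszulD V K _ m c), wedge_mem_chainsIn y hc, by
      rw [koszulD_wedge, sub_add_cancel]⟩

/-- Exactness, in coefficient degree `k`, of the Koszul complex with coefficients in the quotient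
`I_A / I_B` of the spans of the monomials with exponents in `A` and `B`. -/
def KoszulExact (K : Type v) [Field K] (A B : Set (V →₀ ℕ)) (k : ℤ) : Prop :=
  ∀ m, ∀ c ∈ chainsIn (restrictSupport K (A ∩ degreeSet V k)) m,
    c ∈ cyclesMod (restrictSupport K B) m →
      ∃ b ∈ chainsIn (restrictSupport K (A ∩ degreeSet V (k - 1))) (m + 1),
        c - koszulD V K _ m b ∈ chainsIn (restrictSupport K B) m

theorem koszulD_mem_degree {A : Set (V →₀ ℕ)} (hA : IsUpperSet A) {k : ℤ} {m : ℕ}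
    {b : KoszulChain V K (MvPolynomial V K) (m + 1)}
    (hb : b ∈ chainsIn (restrictSupport K (A ∩ degreeSet V (k - 1))) (m + 1)) :
    koszulD V K _ m b ∈ chainsIn (restrictSupport K (A ∩ degreeSet V k)) m :=
  koszulD_mem_chainsIn (A := A ∩ degreeSet V (k - 1))
    (fun v _ ha => by exact ⟨hA.add_single_mem ha.1 v, add_single_mem_degreeSet.2 ha.2⟩) hb

omit [Fintype V] in
theorem restrictSupport_inter (A B : Set (V →₀ ℕ)) {p : MvPolynomial V K} :
    p ∈ restrictSupport K (A ∩ B) ↔ p ∈ restrictSupport K A ∧ p ∈ restrictSupport K B := by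
  simp only [mem_restrictSupport_iff, subset_inter_iff]

omit [Fintype V] in
theorem mem_chainsIn_inter {A B : Set (V →₀ ℕ)} {m : ℕ}
    {c : KoszulChain V K (MvPolynomial V K) m} (hA : c ∈ chainsIn (restrictSupport K A) m)
    (hB : c ∈ chainsIn (restrictSupport K B) m) :
    c ∈ chainsIn (restrictSupport K (A ∩ B)) m :=
  fun t => (restrictSupport_inter A B).2 ⟨hA t, hB t⟩

omit [Fintype V] in
theorem mem_chainsIn_of_subset {A B : Set (V →₀ ℕ)} (h : A ⊆ B) {m : ℕ}
    {c : KoszulChain V K (MvPolynomial V K) m} (hc : c ∈ chainsIn (restrictSupport K A) m) :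
    c ∈ chainsIn (restrictSupport K B) m :=
  chainsIn_mono (restrictSupport_mono K h) m hc

/-- The middle term of the long exact sequence of `0 → I_B/I_C → I_A/I_C → I_A/I_B → 0`: correct a
cycle first into `I_B`, then into `I_C`. -/
theorem KoszulExact.trans {A B C : Set (V →₀ ℕ)} (hA : IsUpperSet A) (hBA : B ⊆ A) (hCB : C ⊆ B)
    {k : ℤ} (h₁ : KoszulExact K A B k) (h₂ : KoszulExact K B C k) : KoszulExact K A C k := by
  intro m c hc hcyc
  obtain ⟨b, hb, hcb⟩ := h₁ m c hc (cyclesMod_mono (restrictSupport_mono K hCB) m hcyc)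
  obtain ⟨b', hb', hcb'⟩ := h₂ m (c - koszulD V K _ m b)
    (mem_chainsIn_inter hcb (mem_chainsIn_of_subset inter_subset_right
      (sub_mem hc (koszulD_mem_degree hA hb))))
    (sub_mem hcyc (koszulD_mem_cyclesMod _ b))
  refine ⟨b + b', add_mem hb (mem_chainsIn_of_subset (inter_subset_inter_left _ hBA) hb'), ?_⟩
  rwa [map_add, ← sub_sub]

/-- Exactness depends only on the quotient `I_A / I_B`, that is on `A \ B`. -/
theorem KoszulExact.congr {A B A' B' : Set (V →₀ ℕ)} (hA : IsUpperSet A) (hB : IsUpperSet B)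
    (hA' : IsUpperSet A') (hB' : IsUpperSet B') (heq : A \ B = A' \ B') {k : ℤ}
    (h : KoszulExact K A' B' k) : KoszulExact K A B k := by
  intro m c hc hcyc
  have hsub : A \ B ⊆ A' := heq ▸ sdiff_subset
  have hsub' : A' \ B' ⊆ A := heq ▸ sdiff_subset
  have hint : A' ∩ B ⊆ B' := fun a ha => by
    by_contra hn
    exact (heq.symm ▸ (⟨ha.1, hn⟩ : a ∈ A' \ B') : a ∈ A \ B).2 ha.2
  have hint' : A ∩ B' ⊆ B := fun a ha => by
    by_contra hn
    exact (heq ▸ (⟨ha.1, hn⟩ : a ∈ A \ B) : a ∈ A' \ B').2 ha.2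
  -- The part `c₂` with exponents in `B` is zero in the quotient; `c₁` lives on `A \ B = A' \ B'`
  -- and is handed to `h`.
  obtain ⟨c₂, hc₂, c₁, hc₁, rfl⟩ := exists_chain_split B _ hc
  have hc₁A : c₁ ∈ chainsIn (restrictSupport K (A' ∩ degreeSet V k)) m :=
    mem_chainsIn_of_subset (fun a ha => by exact ⟨hsub ⟨ha.1.1, ha.2⟩, ha.1.2⟩) hc₁
  have hc₂B : c₂ ∈ chainsIn (restrictSupport K B) m := mem_chainsIn_of_subset inter_subset_right hc₂
  have hc₁B : c₁ ∈ cyclesMod (restrictSupport K B) m := by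
    simpa using sub_mem hcyc (chainsIn_le_cyclesMod hB m hc₂B)
  obtain ⟨b, hb, hcb⟩ := h m c₁ hc₁A
    (cyclesMod_mono (restrictSupport_mono K hint) m (mem_cyclesMod_inter
      (chainsIn_le_cyclesMod hA' m (mem_chainsIn_of_subset inter_subset_left hc₁A)) hc₁B))
  -- Likewise `b₂` is zero modulo `I_{B'}`, and `b₁` has exponents in `A' \ B' ⊆ A`.
  obtain ⟨b₂, hb₂, b₁, hb₁, rfl⟩ := exists_chain_split B' _ hb
  have hb₁A : b₁ ∈ chainsIn (restrictSupport K (A ∩ degreeSet V (k - 1))) (m + 1) :=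
    mem_chainsIn_of_subset (fun a ha => by exact ⟨hsub' ⟨ha.1.1, ha.2⟩, ha.1.2⟩) hb₁
  refine ⟨b₁, hb₁A, ?_⟩
  have h₁ : c₁ - koszulD V K _ m b₁ ∈ chainsIn (restrictSupport K B') m := by
    have : koszulD V K _ m b₂ ∈ chainsIn (restrictSupport K B') m :=
      koszulD_mem_chainsIn (fun v a ha => hB'.add_single_mem ha.2 v) hb₂
    have := add_mem hcb this
    rw [map_add] at this
    convert this using 1
    abel
  have h₂ : c₁ - koszulD V K _ m b₁ ∈ chainsIn (restrictSupport K A) m :=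
    sub_mem (mem_chainsIn_of_subset (fun a ha => ha.1.1) hc₁)
      (mem_chainsIn_of_subset inter_subset_left (koszulD_mem_degree hA hb₁A))
  have := add_mem hc₂B (mem_chainsIn_of_subset hint' (mem_chainsIn_inter h₂ h₁))
  rwa [← add_sub_assoc] at this

/-- Multiplication by a variable identifies `I_A / I_B`, shifted by one, with its image. -/
theorem KoszulExact.shift {A B A' B' : Set (V →₀ ℕ)} {y : V} (hA' : ∀ a ∈ A', a y ≠ 0)
    (hA : ∀ a, a + Finsupp.single y 1 ∈ A' ↔ a ∈ A) (hB : ∀ a, a + Finsupp.single y 1 ∈ B' ↔ a ∈ B)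
    {k : ℤ} (h : KoszulExact K A B (k - 1)) : KoszulExact K A' B' k := by
  intro m c hc hcyc
  -- Divide by `x_y`, solve one degree lower, and multiply back; `∂` commutes with `x_y`.
  obtain ⟨c, hc', rfl⟩ := exists_chain_eq_X_smul (fun a ha => hA' a ha.1) hc
  obtain ⟨b, hb, hcb⟩ := h m c
    (mem_chainsIn_of_subset (fun a ha => by
      exact ⟨(hA a).1 ha.1, add_single_mem_degreeSet.1 ha.2⟩) hc')
    (mem_cyclesMod_of_X_smul (fun a => (hB a).1) hcyc)
  refine ⟨(X y : MvPolynomial V K) • b, X_smul_mem_chainsIn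
    (fun a ha => by exact ⟨(hA a).2 ha.1, add_single_mem_degreeSet.2 ha.2⟩) hb, ?_⟩
  rw [koszulD_smul, show (X y : MvPolynomial V K) • c - (X y : MvPolynomial V K) • koszulD V K _ m b =
    (X y : MvPolynomial V K) • (c - koszulD V K _ m b) by ext1 t; simp [mul_sub]]
  exact X_smul_mem_chainsIn (fun a => (hB a).2) hcb

/-- If a variable `y` is regular on `I_A / I_B`, exactness may be tested modulo `y`. -/
theorem KoszulExact.of_regular {A B : Set (V →₀ ℕ)} {y : V} (hA : IsUpperSet A)
    (hB : IsUpperSet B)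
    (hreg : ∀ a, a + Finsupp.single y 1 ∈ A \ B ↔ a ∈ A \ B) {k : ℤ}
    (h : KoszulExact K A (B ∪ (A ∩ {a | a y ≠ 0})) k) : KoszulExact K A B k := by
  intro m c hc hcyc
  -- With `M = I_A / I_B`, the map `H(M) → H(M / yM)` is injective because `y` acts as zero on
  -- homology. Concretely, `c - ∂b = c₂ + x_y c'` with `c₂` in `I_B`.
  obtain ⟨b, hb, hcb⟩ := h m c hc (cyclesMod_mono (restrictSupport_mono K subset_union_left) m hcyc)
  have hdeg := sub_mem hc (koszulD_mem_degree hA hb)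
  obtain ⟨c₂, hc₂, c₁, hc₁, hsum⟩ := exists_chain_split B _ (mem_chainsIn_inter hcb hdeg)
  have hc₂B : c₂ ∈ chainsIn (restrictSupport K B) m := mem_chainsIn_of_subset inter_subset_right hc₂
  have hc₁' : c₁ ∈ cyclesMod (restrictSupport K B) m := by
    have : c₁ = c - koszulD V K _ m b - c₂ := by rw [hsum]; abel
    rw [this]
    exact sub_mem (sub_mem hcyc (koszulD_mem_cyclesMod _ b)) (chainsIn_le_cyclesMod hB m hc₂B)
  obtain ⟨c', hc', rfl⟩ := exists_chain_eq_X_smul (y := y)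
    (fun a ha => (ha.1.1.resolve_left ha.2).2) hc₁
  have hc'A : c' ∈ chainsIn (restrictSupport K (A ∩ degreeSet V (k - 1))) m :=
    mem_chainsIn_of_subset (fun a ha => by
      exact ⟨((hreg a).1 ⟨ha.1.2.1, ha.2⟩).1, add_single_mem_degreeSet.1 ha.1.2.2⟩) hc'
  -- Regularity cancels `x_y`: `∂c'` lies in `I_A` and `x_y ∂c'` in `I_B`, so `∂c'` lies in `I_B`.
  have hc'B : c' ∈ cyclesMod (restrictSupport K B) m := by
    refine cyclesMod_mono (restrictSupport_mono K ?_) m (mem_cyclesMod_inter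
      (chainsIn_le_cyclesMod hA m (mem_chainsIn_of_subset inter_subset_left hc'A))
      (mem_cyclesMod_of_X_smul (A := {a | a + Finsupp.single y 1 ∈ B}) (fun a ha => ha) hc₁'))
    intro a ha
    by_contra hn
    exact ((hreg a).2 ⟨ha.1, hn⟩).2 ha.2
  obtain ⟨e, he, hye⟩ := exists_X_smul_eq_koszulD_wedge_add y hc'B
  refine ⟨b + wedge y c', add_mem hb (wedge_mem_chainsIn y hc'A), ?_⟩
  have : c - koszulD V K _ m (b + wedge y c') = c₂ + e := by
    rw [map_add, ← sub_sub, hsum, hye]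
    abel
  rw [this]
  exact add_mem hc₂B he

end MonomialModules

/-! ### Chains supported on a subset of the variables -/

section Transfer

variable {V : Type u} {K : Type v} [Field K]

/-- The chains involving only the basis elements `e_v` with `v ∈ T`. -/
def SupportedOn {M : Type w} [AddCommGroup M] [Module K M] (T : Set V) :
    (m : ℕ) → KoszulChain V K M m → Prop
  | 0, _ => True
  | _ + 1, c => ∀ u ∉ T, contract u c = 0

theorem contract_contract_swap (u y : V) {M : Type w} [AddCommGroup M] [Module K M] {m : ℕ}
    (c : KoszulChain V K M (m + 1 + 1)) : contract u (contract y c) = -contract y (contract u c) := by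
  ext1 t
  exact map_vecCons_swap c _ _ t

theorem contract_contract_self (y : V) {M : Type w} [AddCommGroup M] [Module K M] {m : ℕ}
    (c : KoszulChain V K M (m + 1 + 1)) : contract y (contract y c) = 0 := by
  ext1 t
  exact c.map_eq_zero_of_eq _ (i := 0) (j := 1) (by simp) (by simp)

theorem contract_sub (y : V) {M : Type w} [AddCommGroup M] [Module K M] {m : ℕ}
    (c c' : KoszulChain V K M (m + 1)) : contract y (c - c') = contract y c - contract y c' := by
  ext1 t
  simp [contract_apply]

theorem contract_zero (y : V) {M : Type w} [AddCommGroup M] [Module K M] {m : ℕ} :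
    contract y (0 : KoszulChain V K M (m + 1)) = 0 := rfl

theorem wedge_zero (y : V) {M : Type w} [AddCommGroup M] [Module K M] {m : ℕ} :
    wedge y (0 : KoszulChain V K M m) = 0 := by
  ext1 t
  simp [wedge_apply]

theorem wedge_sub (y : V) {M : Type w} [AddCommGroup M] [Module K M] {m : ℕ}
    (c c' : KoszulChain V K M m) : wedge y (c - c') = wedge y c - wedge y c' := by
  ext1 t
  simp [wedge_apply, smul_sub]

variable {M : Type w} [AddCommGroup M] [Module K M] {T : Set V} {y : V}

theorem SupportedOn.mono {T' : Set V} (h : T ⊆ T') {m : ℕ} {c : KoszulChain V K M m}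
    (hc : SupportedOn T m c) : SupportedOn T' m c := by
  cases m with
  | zero => trivial
  | succ m => exact fun u hu => hc u fun h' => hu (h h')

theorem SupportedOn.sub {m : ℕ} {c c' : KoszulChain V K M m} (hc : SupportedOn T m c)
    (hc' : SupportedOn T m c') : SupportedOn T m (c - c') := by
  cases m with
  | zero => trivial
  | succ m =>
    intro u hu
    rw [contract_sub, hc u hu, hc' u hu, sub_zero]

theorem SupportedOn.wedge (hy : y ∈ T) {m : ℕ} {c : KoszulChain V K M m}
    (hc : SupportedOn T m c) : SupportedOn T (m + 1) (wedge y c) := by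
  classical
  intro u hu
  have huy : u ≠ y := fun h => hu (h ▸ hy)
  cases m with
  | zero => rw [contract_wedge_zero, if_neg huy, zero_smul]
  | succ m => rw [contract_wedge, if_neg huy, zero_smul, hc u hu, wedge_zero, sub_zero]

theorem SupportedOn.contract {m : ℕ} {c : KoszulChain V K M (m + 1)}
    (hc : SupportedOn (insert y T) (m + 1) c) : SupportedOn T m (contract y c) := by
  cases m with
  | zero => trivial
  | succ m =>
    intro u hu
    by_cases huy : u = y
    · rw [huy, contract_contract_self]
    · rw [contract_contract_swap, hc u (by simp [huy, hu]), contract_zero, neg_zero]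

/-- In `c = (c - e_y ∧ ι_y c) + e_y ∧ ι_y c` the second summand collects everything that involves
`e_y`. -/
theorem SupportedOn.sub_wedge_contract {m : ℕ} {c : KoszulChain V K M (m + 1)}
    (hc : SupportedOn (insert y T) (m + 1) c) :
    SupportedOn T (m + 1) (c - _root_.wedge y (_root_.contract y c)) := by
  classical
  intro u hu
  by_cases huy : u = y
  · subst huy
    rw [contract_sub]
    cases m with
    | zero => rw [contract_wedge_zero, if_pos rfl, one_smul, sub_self]
    | succ m =>
      rw [contract_wedge, if_pos rfl, one_smul, contract_contract_self, wedge_zero, sub_zero,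
        sub_self]
  · have hu' : u ∉ insert y T := by simp [huy, hu]
    rw [contract_sub, hc u hu', SupportedOn.wedge (mem_insert y T)
      (SupportedOn.mono (subset_insert y T) hc.contract) u hu', sub_zero]

open Classical in
theorem SupportedOn.apply_eq_zero {m : ℕ} {c : KoszulChain V K M m} (hc : SupportedOn T m c)
    {t : Fin m → V → K} {i : Fin m} {u : V} (hu : u ∉ T) (ht : t i = Pi.single u 1) : c t = 0 := by
  cases m with
  | zero => exact i.elim0
  | succ m =>
    rw [← Fin.insertNth_self_removeNth i t, AlternatingMap.map_insertNth, ht]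
    have : c (Matrix.vecCons (Pi.single u 1) (i.removeNth t)) = 0 :=
      DFunLike.congr_fun (hc u hu) (i.removeNth t)
    rw [this, smul_zero]

/-- The extension of a vector by zero. -/
def extendVec (K : Type v) [Field K] (W : Set V) : (W → K) →ₗ[K] V → K :=
  Function.ExtendByZero.linearMap K (Subtype.val : W → V)

/-- The restriction of a vector to a subset of the coordinates. -/
def restrictVec (K : Type v) [Field K] (W : Set V) : (V → K) →ₗ[K] W → K :=
  LinearMap.funLeft K K (Subtype.val : W → V)

theorem extendVec_single [DecidableEq V] {W : Set V} [DecidableEq W] (x : W) :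
    extendVec K W (Pi.single x 1) = Pi.single (x : V) 1 := by
  funext v
  by_cases hv : v ∈ W
  · have := Subtype.val_injective.extend_apply (Pi.single x (1 : K)) (0 : V → K) ⟨v, hv⟩
    refine this.trans ?_
    simp [Pi.single_apply, Subtype.ext_iff]
  · have : extendVec K W (Pi.single x 1) v = (0 : V → K) v :=
      Function.extend_apply' _ _ _ (by rintro ⟨a, rfl⟩; exact hv a.2)
    have hvx : v ≠ x := fun h => hv (h ▸ x.2)
    rw [this, Pi.single_eq_of_ne hvx, Pi.zero_apply]

theorem restrictVec_single [DecidableEq V] {W : Set V} [DecidableEq W] (x : W) :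
    restrictVec K W (Pi.single (x : V) 1) = Pi.single x 1 := by
  funext v
  simp [restrictVec, LinearMap.funLeft_apply, Pi.single_apply, Subtype.ext_iff]

theorem restrictVec_single_of_notMem [DecidableEq V] {W : Set V} {x : V} (hx : x ∉ W) :
    restrictVec K W (Pi.single x 1) = 0 := by
  funext v
  have : (v : V) ≠ x := fun h => hx (h ▸ v.2)
  simp [restrictVec, LinearMap.funLeft_apply, this]

/-- Checked on basis vectors: the projection fixes those in `T` and kills the others, on which `c`
vanishes as well. -/
theorem SupportedOn.apply_extendVec_restrictVec [Fintype V] {m : ℕ} {c : KoszulChain V K M m}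
    (hc : SupportedOn T m c) (t : Fin m → V → K) :
    c (fun i => extendVec K T (restrictVec K T (t i))) = c t := by
  classical
  have : c.compLinearMap ((extendVec K T).comp (restrictVec K T)) = c := by
    refine Module.Basis.ext_alternating (Pi.basisFun K V) fun f _ => ?_
    rw [AlternatingMap.compLinearMap_apply]
    by_cases hf : ∀ i, f i ∈ T
    · congr 1
      funext i
      have h1 := restrictVec_single (K := K) (⟨f i, hf i⟩ : T)
      have h2 := extendVec_single (K := K) (⟨f i, hf i⟩ : T)
      simp only at h1 h2
      simp [Pi.basisFun_apply, h1, h2]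
    · push Not at hf
      obtain ⟨i, hi⟩ := hf
      rw [hc.apply_eq_zero (t := fun i => Pi.basisFun K V (f i)) hi (Pi.basisFun_apply K V (f i))]
      exact c.map_coord_zero i (by simp [Pi.basisFun_apply, restrictVec_single_of_notMem hi])
  exact DFunLike.congr_fun this t

end Transfer

/-! ### Passing from the variables in `W` to all variables -/

section TransferExact

variable {V : Type u} [Fintype V] {K : Type v} [Field K]

/-- The exponents of the monomials divisible by a variable in `N`. -/
def varExps (N : Set V) : Set (V →₀ ℕ) := {a | ∃ u ∈ N, a u ≠ 0}

omit [Fintype V] in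
theorem isUpperSet_varExps (N : Set V) : IsUpperSet (varExps N) := by
  rintro a b hab ⟨u, hu, hau⟩
  exact ⟨u, hu, fun h => hau (Nat.le_zero.1 (h ▸ hab u))⟩

omit [Fintype V] in
theorem mapDomain_notMem_varExps (W : Set V) (a : W →₀ ℕ) :
    a.mapDomain (Subtype.val : W → V) ∉ varExps Wᶜ := by
  rintro ⟨u, hu, hau⟩
  exact hau (Finsupp.mapDomain_of_notMem_range _ _ (by simpa using hu))

omit [Fintype V] in
theorem exists_eq_mapDomain {W : Set V} {a : V →₀ ℕ} (ha : a ∉ varExps Wᶜ) :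
    ∃ b : W →₀ ℕ, b.mapDomain (Subtype.val : W → V) = a := by
  refine ⟨a.comapDomain Subtype.val Subtype.val_injective.injOn,
    Finsupp.mapDomain_comapDomain _ Subtype.val_injective _ fun u hu => ?_⟩
  by_contra hn
  exact ha ⟨u, by simpa using hn, by simpa using hu⟩

omit [Fintype V] in
theorem killCompl_eq_zero {W : Set V} {p : MvPolynomial V K}
    (hp : p ∈ restrictSupport K (varExps Wᶜ)) :
    killCompl (Subtype.val_injective : Function.Injective (Subtype.val : W → V)) p = 0 := by
  ext a
  rw [coeff_killCompl, coeff_zero]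
  by_contra h
  exact mapDomain_notMem_varExps W a (mem_restrictSupport_iff_coeff.1 hp _ h)

omit [Fintype V] in
theorem sub_rename_killCompl_mem {W : Set V} (p : MvPolynomial V K) :
    p - rename Subtype.val
      (killCompl (Subtype.val_injective : Function.Injective (Subtype.val : W → V)) p) ∈
      restrictSupport K (varExps Wᶜ) := by
  rw [mem_restrictSupport_iff_coeff]
  intro a ha
  by_contra hn
  obtain ⟨b, rfl⟩ := exists_eq_mapDomain hn
  rw [coeff_sub, coeff_rename_mapDomain _ Subtype.val_injective, coeff_killCompl, sub_self] at ha
  exact ha rfl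

omit [Fintype V] in
theorem degree_mapDomain_val {W : Set V} (a : W →₀ ℕ) :
    (a.mapDomain (Subtype.val : W → V)).degree = a.degree := by
  classical
  induction a using Finsupp.induction_linear with
  | zero => simp
  | add f g hf hg => rw [Finsupp.mapDomain_add, map_add, map_add, hf, hg]
  | single x n => simp [Finsupp.mapDomain_single]

/-- With `koszulD_rename` this gives chain maps between the complexes over `W` and over `V`: setting
the variables outside `W` to zero, and including. -/
theorem koszulD_killCompl {W : Set V} [Fintype W] {m : ℕ}
    (c : KoszulChain V K (MvPolynomial V K) (m + 1)) (t : Fin m → W → K) :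
    koszulD W K _ m ((killCompl (Subtype.val_injective :
        Function.Injective (Subtype.val : W → V))).toLinearMap.compAlternatingMap
          (c.compLinearMap (extendVec K W))) t =
      killCompl (Subtype.val_injective : Function.Injective (Subtype.val : W → V))
        (koszulD V K _ m c fun i => extendVec K W (t i)) := by
  classical
  rw [koszulD_apply, koszulD_apply, map_sum]
  refine Finset.sum_of_injOn Subtype.val Subtype.val_injective.injOn (by simp) ?_ ?_
  · intro v _ hv
    have hvW : v ∉ W := by simpa using hv
    have : killCompl (Subtype.val_injective : Function.Injective (Subtype.val : W → V))
        (X v : MvPolynomial V K) = 0 := by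
      simp [killCompl, hvW]
    rw [smul_eq_mul, map_mul, this, zero_mul]
  · intro x _
    have : killCompl (Subtype.val_injective : Function.Injective (Subtype.val : W → V))
        (X (x : V) : MvPolynomial V K) = X x := by
      rw [← rename_X, killCompl_rename_app]
    rw [smul_eq_mul, smul_eq_mul, map_mul, this]
    congr 1
    simp only [LinearMap.compAlternatingMap_apply, AlternatingMap.compLinearMap_apply,
      AlgHom.toLinearMap_apply]
    congr 2
    funext i
    refine Fin.cases ?_ (fun i => ?_) i
    · rw [Matrix.cons_val_zero, Matrix.cons_val_zero, ← extendVec_single]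
      congr!
    · simp

theorem koszulD_rename {W : Set V} [Fintype W] {m : ℕ}
    (b : KoszulChain W K (MvPolynomial W K) (m + 1)) (t : Fin m → V → K) :
    koszulD V K _ m ((rename (R := K) (Subtype.val : W → V)).toLinearMap.compAlternatingMap
          (b.compLinearMap (restrictVec K W))) t =
      rename Subtype.val (koszulD W K _ m b fun i => restrictVec K W (t i)) := by
  classical
  have hcons : ∀ v : V, (fun i => restrictVec K W
      ((Matrix.vecCons (Pi.single v 1) t : Fin (m + 1) → V → K) i)) =
      Matrix.vecCons (restrictVec K W (Pi.single v 1)) (fun i => restrictVec K W (t i)) := by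
    intro v
    funext i
    refine Fin.cases ?_ (fun i => ?_) i <;> simp
  rw [koszulD_apply, koszulD_apply, map_sum]
  symm
  refine Finset.sum_of_injOn Subtype.val Subtype.val_injective.injOn (by simp) ?_ ?_
  · intro v _ hv
    have hvW : v ∉ W := by simpa using hv
    rw [LinearMap.compAlternatingMap_apply, AlternatingMap.compLinearMap_apply, hcons,
      restrictVec_single_of_notMem hvW, b.map_coord_zero 0 (by simp), map_zero, smul_zero]
  · intro x _
    rw [LinearMap.compAlternatingMap_apply, AlternatingMap.compLinearMap_apply, hcons,
      restrictVec_single, smul_eq_mul, smul_eq_mul, map_mul, rename_X]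
    congr!

/-- Restrict `c` to `W`, solve there, and include the solution. Restricting and then including
changes a polynomial only by terms in the ideal of the variables outside `W`. -/
theorem exists_supportedOn_of_koszulExact {W : Set V} [Fintype W] {E : Set (V →₀ ℕ)}
    {E' : Set (W →₀ ℕ)} (hE' : ∀ a, a.mapDomain (Subtype.val : W → V) ∈ E ↔ a ∈ E') {k : ℤ}
    (h : KoszulExact K E' ∅ k) {m : ℕ} {c : KoszulChain V K (MvPolynomial V K) m}
    (hc : c ∈ chainsIn (restrictSupport K (E ∩ degreeSet V k)) m)
    (hcyc : c ∈ cyclesMod (restrictSupport K (varExps Wᶜ)) m) (hsupp : SupportedOn W m c) :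
    ∃ b ∈ chainsIn (restrictSupport K (E ∩ degreeSet V (k - 1))) (m + 1),
      SupportedOn W (m + 1) b ∧
        c - koszulD V K _ m b ∈ chainsIn (restrictSupport K (varExps Wᶜ)) m := by
  classical
  set c' : KoszulChain W K (MvPolynomial W K) m := (killCompl (Subtype.val_injective :
    Function.Injective (Subtype.val : W → V))).toLinearMap.compAlternatingMap
      (c.compLinearMap (extendVec K W)) with hc'def
  have hc' : c' ∈ chainsIn (restrictSupport K (E' ∩ degreeSet W k)) m := by
    intro t
    rw [mem_restrictSupport_iff_coeff]
    intro a ha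
    change coeff a (killCompl _ (c _)) ≠ 0 at ha
    rw [coeff_killCompl] at ha
    have := mem_restrictSupport_iff_coeff.1 (hc _) _ ha
    refine ⟨(hE' a).1 this.1, ?_⟩
    have h2 := this.2
    simp only [degreeSet, Set.mem_ofPred_eq] at h2 ⊢
    rw [← h2, degree_mapDomain_val]
  have hcyc' : c' ∈ cyclesMod (restrictSupport K ∅) m := by
    cases m with
    | zero => trivial
    | succ m =>
      intro t
      rw [hc'def, koszulD_killCompl, killCompl_eq_zero (hcyc _)]
      exact zero_mem _
  obtain ⟨b, hb, hcb⟩ := h m c' hc' hcyc'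
  refine ⟨(rename (R := K) (Subtype.val : W → V)).toLinearMap.compAlternatingMap
    (b.compLinearMap (restrictVec K W)), fun t => ?_, fun u hu => ?_, fun t => ?_⟩
  · rw [mem_restrictSupport_iff_coeff]
    intro a ha
    obtain ⟨a, rfl, ha'⟩ := coeff_rename_ne_zero _ _ _ ha
    have := mem_restrictSupport_iff_coeff.1 (hb _) a ha'
    refine ⟨(hE' a).2 this.1, ?_⟩
    have h2 := this.2
    simp only [degreeSet, Set.mem_ofPred_eq] at h2 ⊢
    rw [degree_mapDomain_val, h2]
  · ext1 t
    change rename (R := K) (Subtype.val : W → V) (b _) = 0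
    rw [b.map_coord_zero 0 (by simp [restrictVec_single_of_notMem hu]), map_zero]
  · rw [AlternatingMap.sub_apply, koszulD_rename]
    have hbt := hcb fun i => restrictVec K W (t i)
    have h0 : koszulD W K _ m b (fun i => restrictVec K W (t i)) =
        killCompl (Subtype.val_injective : Function.Injective (Subtype.val : W → V)) (c t) := by
      rw [← hsupp.apply_extendVec_restrictVec t]
      symm
      rw [← sub_eq_zero]
      ext a
      by_contra hn
      exact mem_restrictSupport_iff_coeff.1 hbt a hn
    rw [h0]
    exact sub_rename_killCompl_mem _

/-- Exactness for a monomial ideal of `K[x_v : v ∈ W]` gives exactness over `K[x_v : v ∈ V]`,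
the variables outside `W` acting by zero. -/
theorem KoszulExact.of_subtype {W : Set V} [Fintype W] {E : Set (V →₀ ℕ)} (hE : IsUpperSet E)
    {E' : Set (W →₀ ℕ)} (hE' : ∀ a, a.mapDomain (Subtype.val : W → V) ∈ E ↔ a ∈ E') {k : ℤ}
    (h : KoszulExact K E' ∅ k) : KoszulExact K E (E ∩ varExps Wᶜ) k := by
  classical
  -- The variables outside `W` act as zero, so their basis vectors contribute only an exterior
  -- algebra factor. They are added one at a time. Wedging and contracting preserve the coefficient
  -- degree, so `k` stays fixed.
  have key : ∀ s : Finset V, ∀ m, ∀ c ∈ chainsIn (restrictSupport K (E ∩ degreeSet V k)) m,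
      c ∈ cyclesMod (restrictSupport K (varExps Wᶜ)) m → SupportedOn (W ∪ s) m c →
      ∃ b ∈ chainsIn (restrictSupport K (E ∩ degreeSet V (k - 1))) (m + 1),
        SupportedOn (W ∪ s) (m + 1) b ∧
          c - koszulD V K _ m b ∈ chainsIn (restrictSupport K (varExps Wᶜ)) m := by
    intro s
    induction s using Finset.induction_on with
    | empty =>
      intro m c hc hcyc hsupp
      rw [Finset.coe_empty, union_empty] at hsupp ⊢
      exact exists_supportedOn_of_koszulExact hE' h hc hcyc hsupp
    | insert y s _ ih =>
      intro m c hc hcyc hsupp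
      have hT : W ∪ (↑(insert y s) : Set V) = insert y (W ∪ s) := by
        rw [Finset.coe_insert, union_insert]
      rw [hT] at hsupp ⊢
      by_cases hy : y ∈ W
      · rw [insert_eq_of_mem (show y ∈ W ∪ (s : Set V) from Or.inl hy)] at hsupp ⊢
        exact ih m c hc hcyc hsupp
      have hXy : ∀ (n : ℕ) (c' : KoszulChain V K (MvPolynomial V K) n),
          (X y : MvPolynomial V K) • c' ∈ chainsIn (restrictSupport K (varExps Wᶜ)) n :=
        fun n c' => X_smul_mem_chainsIn (A := univ)
          (fun a _ => by exact ⟨y, hy, by simp⟩) fun t => by simp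
      cases m with
      | zero =>
        obtain ⟨b, hb, hbs, hcb⟩ := ih 0 c hc hcyc trivial
        exact ⟨b, hb, hbs.mono (subset_insert _ _), hcb⟩
      | succ m =>
        -- The coefficient of `e_y` is a cycle, since contraction anticommutes with `∂`.
        obtain ⟨b₁, hb₁, hbs₁, hcb₁⟩ := ih m (contract y c) (contract_mem_chainsIn y hc)
          (by
            cases m with
            | zero => trivial
            | succ m =>
              have := neg_mem (contract_mem_chainsIn y hcyc)
              rwa [contract_koszulD, neg_neg] at this) hsupp.contract
        obtain ⟨b₀, hb₀, hbs₀, hcb₀⟩ := ih (m + 1) (c - wedge y (contract y c))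
          (sub_mem hc (wedge_mem_chainsIn y (contract_mem_chainsIn y hc)))
          (by
            refine sub_mem hcyc ?_
            cases m with
            | zero =>
              rw [mem_cyclesMod_succ, koszulD_wedge_zero]
              exact hXy _ _
            | succ m =>
              rw [mem_cyclesMod_succ, koszulD_wedge]
              refine sub_mem (hXy _ _) (wedge_mem_chainsIn y ?_)
              have := neg_mem (contract_mem_chainsIn y hcyc)
              rwa [contract_koszulD, neg_neg] at this)
          hsupp.sub_wedge_contract
        -- The sign comes from `∂(e_y ∧ b₁) = x_y b₁ - e_y ∧ ∂b₁`, whose first term is zero modulo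
        -- the variables outside `W`.
        refine ⟨b₀ - wedge y b₁, sub_mem hb₀ (wedge_mem_chainsIn y hb₁),
          (hbs₀.mono (subset_insert _ _)).sub
            ((hbs₁.mono (subset_insert _ _)).wedge (mem_insert _ _)), ?_⟩
        have hsum : c - koszulD V K _ (m + 1) (b₀ - wedge y b₁) =
            (c - wedge y (contract y c) - koszulD V K _ (m + 1) b₀) +
              wedge y (contract y c - koszulD V K _ m b₁) + (X y : MvPolynomial V K) • b₁ := by
          rw [map_sub, koszulD_wedge, wedge_sub]
          abel
        rw [hsum]
        exact add_mem (add_mem hcb₀ (wedge_mem_chainsIn y hcb₁)) (hXy _ _)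
  intro m c hc hcyc
  obtain ⟨b, hb, -, hcb⟩ := key Finset.univ m c hc
    (cyclesMod_mono (restrictSupport_mono K inter_subset_right) m hcyc)
    (by cases m with
      | zero => trivial
      | succ m => exact fun u hu => absurd (by simp) hu)
  -- The induction controlled only divisibility by variables outside `W`; membership in `I_E` holds
  -- because `c` and `∂b` both lie there.
  refine ⟨b, hb, mem_chainsIn_inter ?_ hcb⟩
  exact mem_chainsIn_of_subset inter_subset_left (sub_mem hc (koszulD_mem_degree hE hb))

end TransferExact

/-! ### Ideals generated by variables -/

section LinearIdeals

variable {V : Type u} [Fintype V] {K : Type v} [Field K]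

omit [Fintype V] in
theorem isUpperSet_setOf_ne_zero (y : V) : IsUpperSet {a : V →₀ ℕ | a y ≠ 0} :=
  fun _ _ hab ha hb => ha (Nat.le_zero.1 (hb ▸ hab y))

theorem KoszulExact.of_inter_degreeSet_subset {A B : Set (V →₀ ℕ)} {k : ℤ}
    (h : A ∩ degreeSet V k ⊆ B) : KoszulExact K A B k := by
  intro m c hc _
  refine ⟨0, zero_mem _, ?_⟩
  rw [map_zero, sub_zero]
  exact mem_chainsIn_of_subset h hc

/-- The quotient by an ideal generated by variables has regularity at most `0`. -/
theorem koszulExact_univ_varExps (N : Set V) {k : ℤ} (hk : 0 < k) :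
    KoszulExact K univ (varExps N) k := by
  classical
  -- Induction on the complement of `N`: each variable outside `N` is regular on the quotient, and
  -- dividing out all of them leaves `K`, concentrated in degree 0.
  have key : ∀ s : Finset V, KoszulExact K univ (varExps (s : Set V)ᶜ) k := by
    intro s
    induction s using Finset.induction_on with
    | empty =>
      refine KoszulExact.of_inter_degreeSet_subset fun a ha => ?_
      by_contra hn
      have h0 : a = 0 := by
        ext u
        by_contra hu
        exact hn ⟨u, by simp, hu⟩
      have h1 : (a.degree : ℤ) = k := ha.2
      rw [h0] at h1
      simp at h1
      omega
    | insert y s hy ih =>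
      refine KoszulExact.of_regular (y := y) isUpperSet_univ (isUpperSet_varExps _)
        (fun a => ?_) ?_
      · have : a + Finsupp.single y 1 ∈ varExps ((insert y s : Finset V) : Set V)ᶜ ↔
            a ∈ varExps ((insert y s : Finset V) : Set V)ᶜ := by
          constructor
          · rintro ⟨u, hu, hau⟩
            have huy : u ≠ y := fun h => hu (by simp [h])
            exact ⟨u, hu, by simpa [Finsupp.single_apply, huy.symm] using hau⟩
          · exact fun ha => (isUpperSet_varExps _).add_single_mem ha y
        simp only [mem_sdiff, mem_univ, true_and, this]
      · convert ih using 1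
        ext a
        constructor
        · rintro (⟨u, hu, hau⟩ | ⟨-, ha⟩)
          · exact ⟨u, fun h => hu (by simpa using Or.inr h), hau⟩
          · exact ⟨y, by simpa using hy, ha⟩
        · rintro ⟨u, hu, hau⟩
          by_cases huy : u = y
          · exact Or.inr ⟨trivial, huy ▸ hau⟩
          · exact Or.inl ⟨u, by simpa [huy] using hu, hau⟩
  have := key (Nᶜ).toFinset
  rwa [coe_toFinset, compl_compl] at this

/-- An ideal generated by variables has regularity at most `1`. -/
theorem koszulExact_varExps (N : Set V) {k : ℤ} (hk : 1 < k) :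
    KoszulExact K (varExps N) ∅ k := by
  classical
  have key : ∀ s : Finset V, KoszulExact K (varExps (s : Set V)) ∅ k := by
    intro s
    induction s using Finset.induction_on with
    | empty =>
      refine KoszulExact.of_inter_degreeSet_subset ?_
      rintro a ⟨⟨u, hu, -⟩, -⟩
      simp at hu
    | insert y s hy ih =>
      refine KoszulExact.trans (B := varExps (s : Set V)) (isUpperSet_varExps _) ?_
        (empty_subset _) ?_ ih
      · rintro a ⟨u, hu, hau⟩
        exact ⟨u, by simpa using Or.inr hu, hau⟩
      -- `(s, y) / (s)` is `(y) / ((y) ∩ (s))`, which is the quotient by `(s)` shifted by one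
      -- degree.
      · refine KoszulExact.congr (A' := {a | a y ≠ 0})
          (B' := {a | a y ≠ 0} ∩ varExps (s : Set V)) (isUpperSet_varExps _)
          (isUpperSet_varExps _) (isUpperSet_setOf_ne_zero y) ?_ ?_ ?_
        · exact IsUpperSet.inter (isUpperSet_setOf_ne_zero y)
            (isUpperSet_varExps _)
        · ext a
          constructor
          · rintro ⟨⟨u, hu, hau⟩, ha⟩
            rw [Finset.coe_insert] at hu
            rcases hu with rfl | hu
            · exact ⟨hau, fun h => ha h.2⟩
            · exact absurd ⟨u, hu, hau⟩ ha
          · rintro ⟨hay, ha⟩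
            exact ⟨⟨y, by simp, hay⟩, fun h => ha ⟨hay, h⟩⟩
        · refine KoszulExact.shift (y := y) (A := univ) (B := varExps (s : Set V))
            (fun a ha => ha)
            (fun a => iff_of_true (show a + Finsupp.single y 1 ∈ {a : V →₀ ℕ | a y ≠ 0} by simp) trivial)
            (fun a => ?_) (koszulExact_univ_varExps _ (by omega))
          constructor
          · rintro ⟨-, u, hu, hau⟩
            have huy : y ≠ u := fun h => hy (h ▸ hu)
            exact ⟨u, hu, by simpa [Finsupp.single_apply, huy] using hau⟩
          · exact fun ha => ⟨by simp, (isUpperSet_varExps _).add_single_mem ha y⟩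
  have := key N.toFinset
  rwa [coe_toFinset] at this

end LinearIdeals

/-! ### Edge ideals and the deletion inequality -/

section EdgeIdeals

variable {V : Type u} {K : Type v} [Field K]

/-- The exponents of the monomials in the edge ideal. -/
def edgeExps (G : SimpleGraph V) : Set (V →₀ ℕ) := {a | ∃ u v, G.Adj u v ∧ a u ≠ 0 ∧ a v ≠ 0}

theorem isUpperSet_edgeExps (G : SimpleGraph V) : IsUpperSet (edgeExps G) := by
  rintro a b hab ⟨u, v, huv, hu, hv⟩
  exact ⟨u, v, huv, fun h => hu (Nat.le_zero.1 (h ▸ hab u)),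
    fun h => hv (Nat.le_zero.1 (h ▸ hab v))⟩

theorem mem_edgeIdeal {G : SimpleGraph V} {p : MvPolynomial V K} :
    p ∈ edgeIdeal K G ↔ p ∈ restrictSupport K (edgeExps G) := by
  classical
  have hgen : {p : MvPolynomial V K | ∃ x y, G.Adj x y ∧ p = X x * X y} =
      (fun s => monomial s (1 : K)) ''
        {s | ∃ x y, G.Adj x y ∧ s = Finsupp.single x 1 + Finsupp.single y 1} := by
    ext p
    constructor
    · rintro ⟨x, y, hxy, rfl⟩
      exact ⟨_, ⟨x, y, hxy, rfl⟩, by simp [X, monomial_mul]⟩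
    · rintro ⟨_, ⟨x, y, hxy, rfl⟩, rfl⟩
      exact ⟨x, y, hxy, by simp [X, monomial_mul]⟩
  rw [edgeIdeal, hgen, mem_ideal_span_monomial_image, mem_restrictSupport_iff]
  refine forall₂_congr fun a _ => ?_
  constructor
  · rintro ⟨_, ⟨x, y, hxy, rfl⟩, hle⟩
    have hx := hle x
    have hy := hle y
    rw [Finsupp.add_apply] at hx hy
    simp only [Finsupp.single_eq_same] at hx hy
    exact ⟨x, y, hxy, by omega, by omega⟩
  · rintro ⟨x, y, hxy, hx, hy⟩
    refine ⟨_, ⟨x, y, hxy, rfl⟩, fun z => ?_⟩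
    -- Absence of loops makes the generators squarefree, so nonzero exponents at both ends suffice
    -- for divisibility.
    have := hxy.ne
    rw [Finsupp.add_apply, Finsupp.single_apply, Finsupp.single_apply]
    split_ifs with h₁ h₂ h₂
    · exact absurd (h₁.trans h₂.symm) this
    · subst h₁; omega
    · subst h₂; omega
    · omega

theorem mem_idealPiece_edgeIdeal {G : SimpleGraph V} {k : ℤ} (p : edgeIdeal K G) :
    p ∈ idealPiece (edgeIdeal K G) k ↔
      (p : MvPolynomial V K) ∈ restrictSupport K (edgeExps G ∩ degreeSet V k) := by
  have hp := mem_restrictSupport_iff_coeff.1 (mem_edgeIdeal.1 p.2)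
  rw [mem_restrictSupport_iff_coeff]
  exact ⟨fun h a ha => ⟨hp a ha, h a ha⟩, fun h a ha => (h a ha).2⟩

variable [Fintype V]

theorem koszulD_subtype (I : Ideal (MvPolynomial V K)) {m : ℕ} (c : KoszulChain V K I (m + 1))
    (t : Fin m → V → K) :
    ((koszulD V K I m c t : I) : MvPolynomial V K) =
      koszulD V K _ m ((I.restrictScalars K).subtype.compAlternatingMap c) t := by
  rw [koszulD_apply, koszulD_apply, AddSubmonoidClass.coe_finsetSum]
  rfl

/-- `Tor_m` in internal degree `j` is computed by chains with coefficients of degree `k = j - m`, so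
the bound says that homology vanishes for all `k > r` and all `m`. As `I_∅ = 0`, cycles modulo `I_∅`
are genuine cycles. Chains over the ideal are identified with chains over the ring whose
coefficients lie in it. -/
theorem graphReg_le_iff {G : SimpleGraph V} {r : ℝ} :
    graphReg K G ≤ (r : EReal) ↔ ∀ k : ℤ, r < k → KoszulExact K (edgeExps G) ∅ k := by
  let I := edgeIdeal K G
  let ι : I →ₗ[K] MvPolynomial V K := (I.restrictScalars K).subtype
  have lift : ∀ {k : ℤ} {m : ℕ} {c : KoszulChain V K (MvPolynomial V K) m},
      c ∈ chainsIn (restrictSupport K (edgeExps G ∩ degreeSet V k)) m →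
      ∃ c' : KoszulChain V K I m, (∀ t, c' t ∈ idealPiece I k) ∧ ι.compAlternatingMap c' = c := by
    intro k m c hc
    have hI : ∀ t, c t ∈ I.restrictScalars K := fun t =>
      mem_edgeIdeal.2 ((restrictSupport_inter _ _).1 (hc t)).1
    exact ⟨c.codRestrict _ hI, fun t => (mem_idealPiece_edgeIdeal _).2 (hc t), by ext1 t; rfl⟩
  have hι : Function.Injective ι := Subtype.val_injective
  have hιc : ∀ {m : ℕ} {c c' : KoszulChain V K I m},
      ι.compAlternatingMap c = ι.compAlternatingMap c' → c = c' := fun h => by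
    ext1 t
    exact hι (DFunLike.congr_fun h t)
  have hd : ∀ {m : ℕ} (c : KoszulChain V K I (m + 1)), ι.compAlternatingMap (koszulD V K I m c) =
      koszulD V K _ m (ι.compAlternatingMap c) := fun c => by
    ext1 t
    exact koszulD_subtype I c t
  have hbot : ∀ {m : ℕ} {c : KoszulChain V K (MvPolynomial V K) m},
      c ∈ chainsIn (restrictSupport K ∅) m ↔ c = 0 := fun {m c} => by
    constructor
    · intro h
      ext t a
      by_contra hn
      exact mem_restrictSupport_iff_coeff.1 (h t) a hn
    · rintro rfl
      exact zero_mem _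
  have main : graphReg K G ≤ (r : EReal) ↔ ∀ k : ℤ, r < k → ∀ m, ∀ c ∈ koszulCycles V K I m,
      (∀ t, c t ∈ idealPiece I k) → ∃ b, (∀ t, b t ∈ idealPiece I (k - 1)) ∧
        koszulD V K I m b = c := by
    rw [graphReg, regularity, sSup_le_iff]
    constructor
    · intro h k hk m c hc hck
      by_contra! hn
      have := h _ ⟨m, k + m, (nontrivial_gradedTor_iff V _ m _).2 ⟨c, hc, by simpa using hck,
        fun b hb => hn b (by
          rwa [show (k + m - (m + 1 : ℕ) : ℤ) = k - 1 by push_cast; ring] at hb)⟩, rfl⟩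
      rw [EReal.coe_le_coe_iff] at this
      push_cast at this
      linarith
    · rintro h _ ⟨m, j, hj, rfl⟩
      obtain ⟨c, hc, hck, hn⟩ := (nontrivial_gradedTor_iff V _ m _).1 hj
      rw [EReal.coe_le_coe_iff]
      by_contra! hr
      obtain ⟨b, hb, hbc⟩ := h (j - m) (by push_cast; exact hr) m c hc hck
      exact hn b (by simpa [sub_sub] using hb) hbc
  rw [main]
  refine forall₂_congr fun k _ => ⟨fun h m c hc hcyc => ?_, fun h m c hc hck => ?_⟩
  · obtain ⟨c, hck, rfl⟩ := lift hc
    obtain ⟨b, hb, rfl⟩ := h m c (by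
      cases m with
      | zero => trivial
      | succ m =>
        rw [mem_cyclesMod_succ, hbot, ← hd] at hcyc
        exact hιc (hcyc.trans (by ext1 t; rfl))) hck
    refine ⟨ι.compAlternatingMap b, fun t => (mem_idealPiece_edgeIdeal _).1 (hb t), ?_⟩
    rw [hbot, ← hd, sub_self]
  · obtain ⟨b, hb, hcb⟩ := h m (ι.compAlternatingMap c)
      (fun t => (mem_idealPiece_edgeIdeal _).1 (hck t)) (by
      cases m with
      | zero => trivial
      | succ m =>
        have hc0 : koszulD V K I m c = 0 := hc
        rw [mem_cyclesMod_succ, hbot, ← hd, hc0]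
        ext1 t
        rfl)
    obtain ⟨b, hb', rfl⟩ := lift hb
    refine ⟨b, hb', hιc ?_⟩
    rw [hbot, sub_eq_zero] at hcb
    rw [hcb, hd]

omit [Fintype V] in
theorem mapDomain_mem_edgeExps_iff (G : SimpleGraph V) (W : Set V) (a : W →₀ ℕ) :
    a.mapDomain (Subtype.val : W → V) ∈ edgeExps G ↔ a ∈ edgeExps (G.induce W) := by
  constructor
  · rintro ⟨u, v, huv, hu, hv⟩
    have hW : ∀ z, a.mapDomain (Subtype.val : W → V) z ≠ 0 → z ∈ W := fun z hz => by
      by_contra hn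
      exact mapDomain_notMem_varExps W a ⟨z, hn, hz⟩
    refine ⟨⟨u, hW u hu⟩, ⟨v, hW v hv⟩, huv, ?_, ?_⟩
    · rwa [← Finsupp.mapDomain_apply Subtype.val_injective]
    · rwa [← Finsupp.mapDomain_apply Subtype.val_injective]
  · rintro ⟨u, v, huv, hu, hv⟩
    refine ⟨u, v, huv, ?_, ?_⟩
    · rwa [Finsupp.mapDomain_apply Subtype.val_injective]
    · rwa [Finsupp.mapDomain_apply Subtype.val_injective]

/-- The regularity of an edge ideal is at most
`max {2, reg I(G - st x) + 1, reg I(G - x)}`. -/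
theorem graphReg_le_of_star_of_vertex (G : SimpleGraph V) (x : V) [Fintype ↥(graphStar G x)ᶜ]
    [Fintype ↥({x} : Set V)ᶜ] {r : ℝ} (hr : 2 ≤ r)
    (hstar : graphReg K (G.induce (graphStar G x)ᶜ) ≤ ((r - 1 : ℝ) : EReal))
    (hvert : graphReg K (G.induce ({x} : Set V)ᶜ) ≤ (r : EReal)) :
    graphReg K G ≤ (r : EReal) := by
  classical
  rw [graphReg_le_iff] at hstar hvert ⊢
  intro k hk
  have hE := isUpperSet_edgeExps G
  have hN := isUpperSet_varExps (V := V) {y | G.Adj x y}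
  have hx := isUpperSet_setOf_ne_zero x
  -- The bound `2 ≤ r` is needed for `x (N(x))`: regularity at most 1, raised by one by the factor
  -- `x`.
  have hk2 : 1 < k - 1 := by
    have : (2 : ℝ) < k := lt_of_le_of_lt hr hk
    have : (2 : ℤ) < k := by exact_mod_cast this
    omega
  have hJ : IsUpperSet (edgeExps G ∪ varExps {y | G.Adj x y}) := hE.union hN
  have hxN : ∀ a, a + Finsupp.single x 1 ∈ varExps {y | G.Adj x y} ↔
      a ∈ varExps {y | G.Adj x y} := by
    refine fun a => ⟨?_, fun ha => hN.add_single_mem ha x⟩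
    rintro ⟨u, hu, hau⟩
    have hux : x ≠ u := G.ne_of_adj hu
    exact ⟨u, hu, by simpa [Finsupp.single_apply, hux] using hau⟩
  -- The colon ideal `I(G) : x = I(G) + (N(x))`, at the level of exponents.
  have hcolon : ∀ a, a + Finsupp.single x 1 ∈ edgeExps G ↔
      a ∈ edgeExps G ∪ varExps {y | G.Adj x y} := by
    intro a
    constructor
    · rintro ⟨u, v, huv, hu, hv⟩
      have huv' := huv.ne
      by_cases hxu : x = u
      · subst hxu
        exact Or.inr ⟨v, huv, by simpa [Finsupp.single_apply, huv'] using hv⟩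
      by_cases hxv : x = v
      · subst hxv
        exact Or.inr ⟨u, huv.symm, by simpa [Finsupp.single_apply, hxu] using hu⟩
      · exact Or.inl ⟨u, v, huv, by simpa [Finsupp.single_apply, hxu] using hu,
          by simpa [Finsupp.single_apply, hxv] using hv⟩
    · rintro (ha | ⟨u, hu, hau⟩)
      · exact hE.add_single_mem ha x
      · exact ⟨x, u, hu, by simp, by simp [hau]⟩
  refine KoszulExact.trans (B := edgeExps G ∩ {a | a x ≠ 0}) hE inter_subset_left
    (empty_subset _) ?_ ?_
  -- `I(G) / (I(G) ∩ (x))` is `I(G - x)` with `x` acting as zero.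
  · have := KoszulExact.of_subtype hE (mapDomain_mem_edgeExps_iff G _) (hvert k hk)
    have hv : varExps ({x} : Set V)ᶜᶜ = {a : V →₀ ℕ | a x ≠ 0} := by
      ext a
      simp [varExps]
    rwa [hv] at this
  -- `I(G) ∩ (x) = x (I(G) : x)`; dividing by `x` lowers the degree to `k - 1`, whence the `+ 1` on
  -- the star term.
  refine KoszulExact.shift (y := x) (A := edgeExps G ∪ varExps {y | G.Adj x y}) (B := ∅)
    (fun a ha => ha.2) (fun a => ?_) (by simp) ?_
  · rw [mem_inter_iff, hcolon]
    exact and_iff_left (by simp)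
  refine KoszulExact.trans (B := varExps {y | G.Adj x y}) hJ subset_union_right
    (empty_subset _) ?_ (koszulExact_varExps _ hk2)
  -- Modulo `N(x)` no remaining edge meets `x`, so `x` is regular on `(I(G) + (N(x))) / (N(x))`.
  refine KoszulExact.of_regular (y := x) hJ hN (fun a => ?_) ?_
  · rw [mem_sdiff, mem_sdiff, hxN]
    refine and_congr_left fun _ => ⟨?_, fun ha => hJ.add_single_mem ha x⟩
    rintro (ha | ha)
    · exact (hcolon a).1 ha
    · exact Or.inr ((hxN a).1 ha)
  have := KoszulExact.of_subtype hE (mapDomain_mem_edgeExps_iff G _)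
    (hstar (k - 1) (by push_cast; linarith))
  -- The monomials surviving modulo `x` are those of `I(G)` that avoid the whole star.
  refine KoszulExact.congr hJ (hN.union (hJ.inter hx)) hE (hE.inter (isUpperSet_varExps _)) ?_ this
  ext a
  rw [compl_compl]
  constructor
  · rintro ⟨ha, hn⟩
    refine ⟨ha.resolve_right fun h => hn (Or.inl h), ?_⟩
    rintro ⟨-, u, hu | rfl, hau⟩
    · exact hn (Or.inl ⟨u, hu, hau⟩)
    · exact hn (Or.inr ⟨ha, hau⟩)
  · rintro ⟨ha, hn⟩
    refine ⟨Or.inl ha, ?_⟩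
    rintro (⟨u, hu, hau⟩ | ⟨-, hax⟩)
    · exact hn ⟨ha, u, Or.inl hu, hau⟩
    · exact hn ⟨ha, x, Or.inr rfl, hax⟩

/-- The base of the induction: the edge ideal is zero, with regularity `-∞`. -/
theorem graphReg_le_of_isEmpty [IsEmpty V] (G : SimpleGraph V) (r : ℝ) :
    graphReg K G ≤ (r : EReal) := by
  rw [graphReg_le_iff]
  refine fun k _ => KoszulExact.of_inter_degreeSet_subset ?_
  rintro a ⟨⟨u, -⟩, -⟩
  exact isEmptyElim u

end EdgeIdeals

/-! ### The tangent line inequality -/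

section Concave

theorem ConcaveOn.le_add_derivWithin_mul {f : ℝ → ℝ} {S : Set ℝ} (hf : ConcaveOn ℝ S f)
    {x y : ℝ} (hx : x ∈ S) (hy : y ∈ S) (hyx : y < x) (hd : DifferentiableWithinAt ℝ f S x) :
    f y ≤ f x - derivWithin f S x * (x - y) := by
  have h := hf.derivWithin_le_slope hy hx hyx hd
  rw [slope_def_field, le_div_iff₀ (sub_pos.2 hyx)] at h
  linarith

end Concave
end

/-! ### Induction on the number of vertices -/

theorem mainTheorem7 (K : Type v) [Field K]
    (P : ∀ V : Type u, SimpleGraph V → Prop) (hP : StableProperty P)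
    (g f : ℝ → ℝ)
    (hg0 : ∀ x, 0 ≤ x → 0 ≤ g x) (hf0 : ∀ x, 0 ≤ x → 0 ≤ f x)
    (hg : MonotoneOn g (Ici 0)) (hf : MonotoneOn f (Ici 0))
    (h1 : ∀ (V : Type u) [Fintype V] (G : SimpleGraph V) [DecidableRel G.Adj], P V G →
      ∀ d : ℕ, (∀ x, G.degree x ≤ d) → graphReg K G ≤ ((g d : ℝ) : EReal))
    (h2 : ConcaveOn ℝ (Ici 0) f) (h2_diff : DifferentiableOn ℝ f (Ici 0)) (h2_one : 2 ≤ f 1)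
    (h3_pos : ∀ x, 0 ≤ x → 0 < derivWithin f (Ici 0) x)
    (h3 : ∀ x, 0 ≤ x → 0 ≤ 1 / derivWithin f (Ici 0) x - 1 →
      g (1 / derivWithin f (Ici 0) x - 1) ≤ f x)
    (V : Type u) [Fintype V] (G : SimpleGraph V) (hG : P V G) :
    graphReg K G ≤ ((f (Fintype.card V) : ℝ) : EReal) := by
  classical
  induction hn : Fintype.card V using Nat.strong_induction_on generalizing V with
  | _ n ih =>
  subst hn
  rcases isEmpty_or_nonempty V with hV | hV
  · exact graphReg_le_of_isEmpty G _
  obtain ⟨x, -, hx⟩ := Finset.exists_max_image Finset.univ (fun y => G.degree y) Finset.univ_nonempty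
  replace hx : ∀ y, G.degree y ≤ G.degree x := fun y => hx y (Finset.mem_univ y)
  obtain ⟨hPstar, hPvert⟩ := hP V G hG x hx
  have hn0 : (0 : ℝ) ≤ Fintype.card V := Nat.cast_nonneg _
  have hn1 : (1 : ℝ) ≤ Fintype.card V := by exact_mod_cast Fintype.card_pos
  by_cases hgd : g (G.degree x) ≤ f (Fintype.card V)
  · exact (h1 V G hG (G.degree x) hx).trans (by exact_mod_cast hgd)
  push Not at hgd
  -- Otherwise `d ≤ 1/f'(n) - 1`, so this argument is nonnegative and condition 3 gives `g(d) ≤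
  -- g(1/f'(n) - 1) ≤ f(n)`, contrary to `hgd`.
  have hder : 1 ≤ derivWithin f (Ici 0) (Fintype.card V) * (G.degree x + 1) := by
    by_contra! hlt
    have hpos := h3_pos _ hn0
    have hle : (G.degree x : ℝ) ≤ 1 / derivWithin f (Ici 0) (Fintype.card V) - 1 := by
      rw [le_sub_iff_add_le, le_div_iff₀ hpos]
      linarith
    have hd0 : (0 : ℝ) ≤ G.degree x := Nat.cast_nonneg _
    have := h3 _ hn0 (hd0.trans hle)
    have := hg (mem_Ici.2 hd0) (mem_Ici.2 (hd0.trans hle)) hle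
    linarith
  have hcardstar : Fintype.card ↥(graphStar G x)ᶜ + (G.degree x + 1) = Fintype.card V := by
    have h : (graphStar G x).toFinset = insert x (G.neighborFinset x) := by
      ext y
      rw [mem_toFinset]
      simp [graphStar]
    have hc : Fintype.card ↥(graphStar G x) = G.degree x + 1 := by
      rw [← toFinset_card, h, Finset.card_insert_of_notMem (by simp), G.card_neighborFinset_eq_degree]
    have := Fintype.card_compl_set (graphStar G x)
    have := set_fintype_card_le_univ (graphStar G x)
    omega
  have hcardvert : Fintype.card ↥({x} : Set V)ᶜ + 1 = Fintype.card V := by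
    have := Fintype.card_compl_set ({x} : Set V)
    have := Fintype.card_pos (α := V)
    simp at *
    omega
  refine graphReg_le_of_star_of_vertex G x ?_ ?_ ?_
  · exact h2_one.trans (hf (mem_Ici.2 zero_le_one) (mem_Ici.2 hn0) hn1)
  · refine (ih _ (by omega) ↥(graphStar G x)ᶜ _ hPstar rfl).trans ?_
    rw [EReal.coe_le_coe_iff]
    have hcast : ((Fintype.card ↥(graphStar G x)ᶜ : ℕ) : ℝ) + (G.degree x + 1) =
        Fintype.card V := by exact_mod_cast hcardstar
    have hd0 : (0 : ℝ) ≤ G.degree x := Nat.cast_nonneg _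
    -- The tangent at `n`, evaluated at `n - (d + 1)`, the number of vertices left after deleting
    -- the star; by `hder` it has dropped by at least 1.
    have := h2.le_add_derivWithin_mul (mem_Ici.2 hn0)
      (mem_Ici.2 (Nat.cast_nonneg (Fintype.card ↥(graphStar G x)ᶜ))) (by linarith) (h2_diff _ hn0)
    rw [← hcast, add_sub_cancel_left, hcast] at this
    linarith
  · refine (ih _ (by omega) ↥({x} : Set V)ᶜ _ hPvert rfl).trans ?_
    rw [EReal.coe_le_coe_iff]
    refine hf (mem_Ici.2 (Nat.cast_nonneg _)) (mem_Ici.2 hn0) ?_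
    exact_mod_cast (by omega : Fintype.card ↥({x} : Set V)ᶜ ≤ Fintype.card V)
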